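/- All near-rings $(N,+,*)$ here are right near-rings ($(N,+)$ is a group, not necessarily abelian, $*$ is associative and $(a+b)*c=a*c+b*c$) that are zero-symmetric ($0*n=n*0=0$) and have a multiplicative identity $1$. Let $U$ be the group of units of $N$ and, for $u\in U$, let $\psi_u\colon n\mapsto n*u$, an automorphism of $(N,+)$; put $\Psi_U=\{\psi_u : u\in U\}$. $N$ is an *f-near-ring* if $\Psi_U$ is a fixed point free group of automorphisms of $(N,+)$, i.e. no non-identity element of $\Psi_U$ fixes a non-zero element of $N$. $N$ is an *a-near-ring* if $U\cup\{0\}$ is a sub-near-field of $N$, where a *near-field* is a near-ring with $1\neq 0$ in which every non-zero element is a unit. $N$ has *DCCN* if every descending chain of $N$-subgroups of $N$ (subgroups $M\le (N,+)$ with $NM\subseteq M$) becomes stationary. An *$N$-group* is an additively written, not necessarily abelian group $\Gamma$ with a map $N\times\Gamma\to\Gamma$ such that $(m+n)\gamma=m\gamma+n\gamma$ and $(m*n)\gamma=m(n\gamma)$; it is *of type 2* if $\Gamma\neq\{0\}$, $N\gamma=\Gamma$ for some $\gamma\in\Gamma$, and $\{0\}$ and $\Gamma$ are the only subgroups $\Delta$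 of $\Gamma$ with $N\Delta\subseteq\Delta$. $J_2(N)$ is the intersection of the annihilators $\{n\in N : n\Gamma=\{0\}\}$ of all $N$-groups $\Gamma$ of type 2 (and $J_2(N)=N$ if there are none). $M_0(\mathbb{Z}_3)$ is the near-ring of all maps $f\colon\mathbb{Z}_3\to\mathbb{Z}_3$ with $f(0)=0$, under pointwise addition and composition. **Theorem.** Let $N$ be an f-near-ring or an a-near-ring with DCCN that is not a ring (i.e. its addition is not commutative or left distributivity fails). If $J_2(N)=\{0\}$, then $N$ is a near-field or $N\cong M_0(\mathbb{Z}_3)$ as near-rings. -/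

import Mathlib

universe u v

/-- A zero-symmetric (right) near-ring: a not necessarily commutative additive group with an
associative multiplication such that `(a + b) * c = a * c + b * c` and `n * 0 = 0 * n = 0`. -/
class NearRing (N : Type u) extends AddGroup N, SemigroupWithZero N, RightDistribClass N

/-- A zero-symmetric near-ring with a two-sided multiplicative identity. -/
class UnitalNearRing (N : Type u) extends NearRing N, MonoidWithZero N

/-- The near-ring is a ring: addition is commutative and both distributive laws hold. -/
def IsRingNR (N : Type u) [NearRing N] : Prop :=
  (∀ a b : N, a + b = b + a) ∧ ∀ a b c : N, a * (b + c) = a * b + a * c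

/-- A near-field: `0 ≠ 1` and all non-zero elements are units. -/
def IsNearField (N : Type u) [UnitalNearRing N] : Prop :=
  (0 : N) ≠ 1 ∧ ∀ x : N, x ≠ 0 → IsUnit x

section NGroups

/-- An `N`-group: an additive group `Γ` with a map `N × Γ → Γ` satisfying
`(m + n)γ = mγ + nγ` and `(mn)γ = m(nγ)`. -/
class NGroup (N : Type u) [NearRing N] (Γ : Type v) [AddGroup Γ] extends SMul N Γ where
  add_smul' : ∀ (m n : N) (γ : Γ), (m + n) • γ = m • γ + n • γ
  mul_smul' : ∀ (m n : N) (γ : Γ), (m * n) • γ = m • (n • γ)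

/-- A near-ring is an `N`-group over itself by left multiplication. -/
instance NearRing.instNGroupSelf (N : Type u) [NearRing N] : NGroup N N where
  smul n m := n * m
  add_smul' := fun m n γ => add_mul m n γ
  mul_smul' := fun m n γ => mul_assoc m n γ

/-- The subgroup `Δ` of the `N`-group `Γ` is an `N`-subgroup: `NΔ ⊆ Δ`. -/
def IsNSubgroup (N : Type u) [NearRing N] {Γ : Type v} [AddGroup Γ] [NGroup N Γ]
    (Δ : AddSubgroup Γ) : Prop :=
  ∀ (n : N), ∀ δ ∈ Δ, n • δ ∈ Δ

/-- DCCN: every descending chain of `N`-subgroups of `N` becomes stationary. -/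
def HasDCCN (N : Type u) [NearRing N] : Prop :=
  ∀ L : ℕ → AddSubgroup N, (∀ k, IsNSubgroup N (L k)) → (∀ k, L (k + 1) ≤ L k) →
    ∃ k, ∀ m, k ≤ m → L m = L k

/-- An `N`-group of type 2 (for zero-symmetric `N`): `Γ` is non-zero, monogenic (`Nγ = Γ` for
some `γ`), and its only `N`-subgroups are `{0}` and `Γ`. -/
structure IsTypeTwo (N : Type u) [NearRing N] (Γ : Type v) [AddGroup Γ] [NGroup N Γ] : Prop where
  nontrivial : Nontrivial Γ
  monogenic : ∃ γ : Γ, ∀ δ : Γ, ∃ n : N, n • γ = δ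
  simple : ∀ Δ : AddSubgroup Γ, IsNSubgroup N Δ → Δ = ⊥ ∨ Δ = ⊤

/-- The radical `J₂(N)`: the intersection of the annihilators of all `N`-groups of type 2 (so
`J₂(N) = N` if there are none). It suffices to let `Γ` range over the universe of `N`: an
`N`-group `Γ` of type 2 is monogenic, so it is isomorphic, via `n ↦ nγ`, to a quotient of `N`. -/
def JTwo (N : Type u) [NearRing N] : Set N :=
  {n | ∀ (Γ : Type u) [AddGroup Γ] [NGroup N Γ], IsTypeTwo N Γ → ∀ γ : Γ, n • γ = 0}

end NGroups

section FNearRings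

/-- For a unit `u`, the right translation `ψ_u : n ↦ n * u`, an automorphism of `(N, +)`. -/
def rightTranslation {N : Type u} [UnitalNearRing N] (u : Nˣ) : AddAut N where
  toFun n := n * u
  invFun n := n * (↑u⁻¹ : N)
  left_inv n := Units.mul_inv_cancel_right n u
  right_inv n := Units.inv_mul_cancel_right n u
  map_add' a b := add_mul a b (u : N)

/-- The group `Ψ_U` of all right translations by units, under composition (Mathlib writes the group
`AddAut N` additively: `φ + χ` is the composition and `0` is the identity map). -/
def unitTranslations (N : Type u) [UnitalNearRing N] : AddSubgroup (AddAut N) where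
  carrier := Set.range rightTranslation
  add_mem' := by
    rintro _ _ ⟨u, rfl⟩ ⟨w, rfl⟩
    refine ⟨w * u, ?_⟩
    ext n
    change n * ((w * u : Nˣ) : N) = n * (w : N) * (u : N)
    rw [Units.val_mul, mul_assoc]
  zero_mem' := by
    refine ⟨1, ?_⟩
    ext n
    exact mul_one n
  neg_mem' := by
    rintro _ ⟨u, rfl⟩
    exact ⟨u⁻¹, by ext n; rfl⟩

/-- A fixed point free automorphism group of `G`: no member of `Φ` other than the identity
map (written `0`) fixes a non-zero element. -/
def IsFixedPointFreeAutGroup {G : Type u} [AddGroup G] (Φ : AddSubgroup (AddAut G)) : Prop :=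
  ∀ φ ∈ Φ, φ ≠ 0 → ∀ g : G, φ g = g → g = 0

/-- f-near-rings: `Ψ_U` is a fixed point free automorphism group of `(N, +)`. -/
def IsFNearRing (N : Type u) [UnitalNearRing N] : Prop :=
  IsFixedPointFreeAutGroup (unitTranslations N)

end FNearRings

section ANearRings

/-- `S` is a sub-near-field of `N`: an additive subgroup, closed under multiplication, with an
identity `e ≠ 0` of its own and an inverse in `S` of every non-zero element. -/
structure IsSubNearField {N : Type u} [NearRing N] (S : Set N) : Prop where
  zero_mem : (0 : N) ∈ S
  add_mem : ∀ a ∈ S, ∀ b ∈ S, a + b ∈ S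
  neg_mem : ∀ a ∈ S, -a ∈ S
  mul_mem : ∀ a ∈ S, ∀ b ∈ S, a * b ∈ S
  exists_identity_inverse : ∃ e ∈ S, e ≠ 0 ∧ (∀ a ∈ S, e * a = a ∧ a * e = a) ∧
    ∀ a ∈ S, a ≠ 0 → ∃ b ∈ S, a * b = e ∧ b * a = e

/-- a-near-rings: the set `U₀` of the units together with `0` is a sub-near-field. -/
def IsANearRing (N : Type u) [UnitalNearRing N] : Prop :=
  IsSubNearField {x : N | IsUnit x ∨ x = 0}

end ANearRings

section MZeroNearRing

/-- `M₀(G)`: the maps `f : G → G` with `f 0 = 0`. -/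
@[ext]
structure MZero (G : Type u) [AddGroup G] where
  toFun : G → G
  map_zero' : toFun 0 = 0

variable {G : Type u} [AddGroup G]

/-- Addition on `M₀(G)` is pointwise. -/
instance MZero.instAdd : Add (MZero G) :=
  ⟨fun f g => ⟨fun x => f.toFun x + g.toFun x, by rw [f.map_zero', g.map_zero', add_zero]⟩⟩

instance MZero.instZero : Zero (MZero G) := ⟨⟨fun _ => 0, rfl⟩⟩

instance MZero.instNeg : Neg (MZero G) :=
  ⟨fun f => ⟨fun x => -f.toFun x, by rw [f.map_zero', neg_zero]⟩⟩

instance MZero.instAddGroup : AddGroup (MZero G) :=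
  AddGroup.ofLeftAxioms
    (fun _ _ _ => MZero.ext (funext fun _ => add_assoc _ _ _))
    (fun _ => MZero.ext (funext fun _ => zero_add _))
    (fun _ => MZero.ext (funext fun _ => neg_add_cancel _))

/-- Multiplication is composition of maps, `(f * g) x = f (g x)`. -/
instance MZero.instUnitalNearRing : UnitalNearRing (MZero G) where
  toAddGroup := MZero.instAddGroup
  mul f g := ⟨fun x => f.toFun (g.toFun x), by rw [g.map_zero', f.map_zero']⟩
  one := ⟨fun x => x, rfl⟩
  mul_assoc f g h := rfl
  zero_mul f := rfl
  mul_zero f := MZero.ext (funext fun x => f.map_zero')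
  right_distrib f g h := rfl
  one_mul f := rfl
  mul_one f := rfl

end MZeroNearRing

/-! Annihilators of non-zero points of type 2 `N`-groups meet in 0, and DCCN lets finitely many of
them suffice. An irredundant finite family behaves as in the Chinese remainder theorem: it yields
orthogonal idempotents `e i` splitting `N` into minimal `N`-subgroups `N * e i`, on which left
multiplication can be prescribed independently (`exists_isFrame`). With one block `N` is a
near-field. With several blocks, the f- and a-conditions enter only through `unit_eq_one_of_fixes`:
a unit altering one block but trivial on another must be 1. Hence every corner `e i * N * e i` is
`{0, e i}` (`corner_eq`). If no two blocks are linked, each has two elements and `N` is a ring. If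
two are linked, the unit swapping them rules out a third block, and `N * e i` contains at most 0, `e
i`, `p` and `e i + p`. A fourth point again makes `N` a ring (`isRing_of_third_point`); otherwise
the block is a copy of ℤ/3 on which `N` acts by all zero-fixing maps. -/

section Annihilators

/-! ### Point annihilators and finite intersections. -/

variable {N : Type u}

theorem NearRing.neg_mul' [NearRing N] (a c : N) : -a * c = -(a * c) :=
  eq_neg_of_add_eq_zero_left (by rw [← add_mul, neg_add_cancel, zero_mul])

theorem NearRing.sub_mul' [NearRing N] (a b c : N) : (a - b) * c = a * c - b * c := by
  rw [sub_eq_add_neg, add_mul, NearRing.neg_mul', ← sub_eq_add_neg]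

/-- The left ideals that arise as annihilators of non-zero points of `N`-groups of type 2. -/
structure IsPointAnnihilator [UnitalNearRing N] (L : AddSubgroup N) : Prop where
  one_notMem : (1 : N) ∉ L
  mul_sub : ∀ n a b : N, a - b ∈ L → n * a - n * b ∈ L
  add_sub : ∀ a a' b b' : N, a - a' ∈ L → b - b' ∈ L → (a + b) - (a' + b') ∈ L
  transitive : ∀ x : N, x ∉ L → ∀ y : N, ∃ z : N, z * x - y ∈ L

theorem IsPointAnnihilator.mul_mem [UnitalNearRing N] {L : AddSubgroup N}
    (hL : IsPointAnnihilator L) (n : N) {a : N} (ha : a ∈ L) : n * a ∈ L := by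
  have := hL.mul_sub n a 0 (by simpa using ha)
  simpa using this

namespace NGroup

variable {Γ : Type u} [AddGroup Γ]

theorem zero_smul' [NearRing N] [NGroup N Γ] (γ : Γ) : (0 : N) • γ = 0 := by
  have h := NGroup.add_smul' (0 : N) 0 γ
  rw [add_zero] at h
  exact left_eq_add.mp h

theorem smul_zero' [NearRing N] [NGroup N Γ] (n : N) : n • (0 : Γ) = 0 := by
  rw [← zero_smul' (N := N) (0 : Γ), ← NGroup.mul_smul', mul_zero]

/-- Evaluation at a point of an `N`-group, as an additive homomorphism. -/
def evalHom (N : Type u) [NearRing N] [NGroup N Γ] (γ : Γ) : N →+ Γ where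
  toFun n := n • γ
  map_zero' := zero_smul' γ
  map_add' m n := NGroup.add_smul' m n γ

theorem evalHom_apply [NearRing N] [NGroup N Γ] (γ : Γ) (n : N) : evalHom N γ n = n • γ := rfl

theorem one_smul_of_isTypeTwo [UnitalNearRing N] [NGroup N Γ] (h : IsTypeTwo N Γ) (γ : Γ) :
    (1 : N) • γ = γ := by
  obtain ⟨γ₀, h₀⟩ := h.monogenic
  obtain ⟨n, rfl⟩ := h₀ γ
  rw [← NGroup.mul_smul', one_mul]

theorem exists_smul_eq_of_isTypeTwo [UnitalNearRing N] [NGroup N Γ] (h : IsTypeTwo N Γ) {γ : Γ}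
    (hγ : γ ≠ 0) (δ : Γ) : ∃ n : N, n • γ = δ := by
  have hsub : IsNSubgroup N (evalHom N γ).range := by
    rintro n _ ⟨m, rfl⟩
    exact ⟨n * m, NGroup.mul_smul' n m γ⟩
  rcases h.simple _ hsub with hb | ht
  · have : (1 : N) • γ ∈ (evalHom N γ).range := ⟨1, rfl⟩
    rw [hb, one_smul_of_isTypeTwo h, AddSubgroup.mem_bot] at this
    exact absurd this hγ
  · have : δ ∈ (evalHom N γ).range := ht ▸ AddSubgroup.mem_top δ
    exact this

theorem isPointAnnihilator_ker_evalHom [UnitalNearRing N] [NGroup N Γ] (h : IsTypeTwo N Γ) {γ : Γ}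
    (hγ : γ ≠ 0) : IsPointAnnihilator (evalHom N γ).ker := by
  have key : ∀ a b : N, a - b ∈ (evalHom N γ).ker ↔ a • γ = b • γ := fun a b => by
    rw [AddMonoidHom.mem_ker, map_sub, sub_eq_zero, evalHom_apply, evalHom_apply]
  refine ⟨?_, ?_, ?_, ?_⟩
  · rwa [AddMonoidHom.mem_ker, evalHom_apply, one_smul_of_isTypeTwo h]
  · intro n a b hab
    rw [key] at hab ⊢
    rw [NGroup.mul_smul', NGroup.mul_smul', hab]
  · intro a a' b b' ha hb
    rw [key] at ha hb ⊢
    rw [NGroup.add_smul', NGroup.add_smul', ha, hb]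
  · intro x hx y
    obtain ⟨z, hz⟩ := exists_smul_eq_of_isTypeTwo h (γ := x • γ) hx (y • γ)
    exact ⟨z, by rw [key, NGroup.mul_smul', hz]⟩

end NGroup

theorem exists_isPointAnnihilator_notMem [UnitalNearRing N] (hJ : JTwo N = {0}) {x : N}
    (hx : x ≠ 0) : ∃ L : AddSubgroup N, IsPointAnnihilator L ∧ x ∉ L := by
  by_contra! hcon
  refine hx ?_
  have hmem : x ∈ JTwo N := by
    intro Γ _ _ hΓ γ
    by_cases hγ : γ = 0
    · rw [hγ, NGroup.smul_zero']
    · exact hcon _ (NGroup.isPointAnnihilator_ker_evalHom hΓ hγ)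
  rwa [hJ] at hmem

/-- Otherwise each finite intersection contains a non-zero element, which some further annihilator
omits; iterating gives a strictly descending chain of `N`-subgroups. -/
theorem exists_finset_inf_eq_bot [UnitalNearRing N] (hdcc : HasDCCN N) (hJ : JTwo N = {0}) :
    ∃ F : Finset (AddSubgroup N), (∀ L ∈ F, IsPointAnnihilator L) ∧ F.inf id = ⊥ := by
  classical
  by_contra! hcon
  have step : ∀ F : {F : Finset (AddSubgroup N) // ∀ L ∈ F, IsPointAnnihilator L},
      ∃ F' : {F : Finset (AddSubgroup N) // ∀ L ∈ F, IsPointAnnihilator L},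
        F'.1.inf id < F.1.inf id := by
    rintro ⟨F, hF⟩
    obtain ⟨x, hxF, hx⟩ := (AddSubgroup.ne_bot_iff_exists_ne_zero.mp (hcon F hF) |>.elim
      fun a ha => ⟨a.1, a.2, fun h => ha (Subtype.ext h)⟩ : ∃ x ∈ F.inf id, x ≠ 0)
    obtain ⟨L, hL, hxL⟩ := exists_isPointAnnihilator_notMem hJ hx
    refine ⟨⟨insert L F, fun M hM => ?_⟩, ?_⟩
    · rcases Finset.mem_insert.mp hM with rfl | hM
      exacts [hL, hF M hM]
    · rw [Finset.inf_insert]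
      exact lt_of_le_of_ne inf_le_right fun h => hxL (inf_eq_right.mp h hxF)
  choose next hnext using step
  let seq : ℕ → {F : Finset (AddSubgroup N) // ∀ L ∈ F, IsPointAnnihilator L} :=
    fun k => next^[k] ⟨∅, by simp⟩
  have hseq : ∀ k, (seq (k + 1)).1.inf id < (seq k).1.inf id := fun k => by
    simp only [seq, Function.iterate_succ_apply']
    exact hnext _
  have hsub : ∀ k, IsNSubgroup N ((seq k).1.inf id) := fun k n x hx => by
    have hmem : ∀ y : N, y ∈ (seq k).1.inf id ↔ ∀ L ∈ (seq k).1, y ∈ L := fun y => by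
      simp [Finset.inf_eq_iInf, AddSubgroup.mem_iInf]
    rw [hmem] at hx ⊢
    exact fun L hL => ((seq k).2 L hL).mul_mem n (hx L hL)
  obtain ⟨k, hk⟩ := hdcc _ hsub fun k => (hseq k).le
  exact (hseq k).ne (hk (k + 1) k.le_succ)

/-! ### Orthogonal idempotents from an irredundant family. -/

/-- A family of orthogonal idempotents decomposing `N` into a direct sum of minimal `N`-subgroups
`N * e i`. -/
structure IsFrame [UnitalNearRing N] {ι : Type u} (e : ι → N) : Prop where
  ne_zero : ∀ i, e i ≠ 0
  idem : ∀ i, e i * e i = e i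
  ortho : ∀ i j, i ≠ j → e i * e j = 0
  ext : ∀ a b : N, (∀ i, a * e i = b * e i) → a = b
  exists_mul_eq : ∀ x : ι → N, ∃ n : N, ∀ i, n * e i = x i * e i
  minimal : ∀ i (x : N), x * e i ≠ 0 → ∃ z : N, z * (x * e i) = e i

/-- The point is that `L i` is exactly the annihilator of `e i`: if `a` and `b` agree modulo `L i`,
then `a * e i` and `b * e i` agree modulo every `L j`. Each frame axiom is thus checked by
congruences. -/
theorem isFrame_of_dual [UnitalNearRing N] {ι : Type u} [Fintype ι] {L : ι → AddSubgroup N}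
    (hL : ∀ i, IsPointAnnihilator (L i)) (hbot : ∀ x : N, (∀ i, x ∈ L i) → x = 0) {e : ι → N}
    (hone : ∀ i, e i - 1 ∈ L i) (hmem : ∀ i j, i ≠ j → e i ∈ L j) : IsFrame e := by
  classical
  have trans : ∀ {i : ι} {a b c : N}, a - b ∈ L i → b - c ∈ L i → a - c ∈ L i :=
    fun {i a b c} h₁ h₂ => by simpa using (L i).add_mem h₁ h₂
  have symm : ∀ {i : ι} {a b : N}, a - b ∈ L i → b - a ∈ L i :=
    fun {i a b} h => by simpa using (L i).neg_mem h
  have eq_of : ∀ a b : N, (∀ i, a - b ∈ L i) → a = b := fun a b h => sub_eq_zero.mp (hbot _ h)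
  have hself : ∀ i (a : N), a * e i - a ∈ L i := fun i a => by
    simpa using (hL i).mul_sub a _ _ (hone i)
  have hother : ∀ {i j} (a : N), i ≠ j → a * e i ∈ L j := fun a h =>
    (hL _).mul_mem a (hmem _ _ h)
  have eq_mul : ∀ i (a b : N), a - b ∈ L i → a * e i = b * e i := fun i a b hab =>
    eq_of _ _ fun j => by
      by_cases hij : i = j
      · subst hij
        exact trans (hself i a) (trans hab (symm (hself i b)))
      · exact (L j).sub_mem (hother a hij) (hother b hij)
  have mul_eq_zero' : ∀ i (a : N), a ∈ L i → a * e i = 0 := fun i a ha => by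
    simpa using eq_mul i a 0 (by simpa using ha)
  refine ⟨fun i h => (hL i).one_notMem ?_, fun i => ?_, fun i j hij => ?_, fun a b h => ?_,
    fun x => ?_, fun i x hx => ?_⟩
  · have := hone i
    rw [h, zero_sub] at this
    simpa using this
  · simpa using eq_mul i _ _ (hone i)
  · exact mul_eq_zero' j _ (hmem i j hij)
  · refine eq_of _ _ fun i => trans (symm (hself i a)) ?_
    rw [h i]
    exact hself i b
  -- The solution is the sum of the `x i * e i`; building it by induction avoids fixing an order for
  -- a possibly non-commutative sum.
  · have : ∀ s : Finset ι, ∃ n : N, (∀ i ∈ s, n - x i ∈ L i) ∧ ∀ i ∉ s, n ∈ L i := by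
      intro s
      induction s using Finset.induction_on with
      | empty => exact ⟨0, by simp, fun i _ => (L i).zero_mem⟩
      | insert i s his ih =>
        obtain ⟨n, hn, hn'⟩ := ih
        refine ⟨n + x i * e i, fun j hj => ?_, fun j hj => ?_⟩
        · by_cases hij : i = j
          · subst hij
            simpa using (hL i).add_sub n 0 (x i * e i) (x i) (by simpa using hn' i his)
              (hself i (x i))
          · have hjs : j ∈ s := (Finset.mem_insert.mp hj).resolve_left (Ne.symm hij)
            simpa using (hL j).add_sub n (x j) (x i * e i) 0 (hn j hjs)
              (by simpa using hother (x i) hij)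
        · rw [Finset.mem_insert, not_or] at hj
          exact (L j).add_mem (hn' j hj.2) (hother _ (Ne.symm hj.1))
    obtain ⟨n, hn, -⟩ := this Finset.univ
    exact ⟨n, fun i => eq_mul i _ _ (hn i (Finset.mem_univ i))⟩
  · obtain ⟨z, hz⟩ := (hL i).transitive x (fun h => hx (mul_eq_zero' i x h)) 1
    exact ⟨z, by rw [← mul_assoc, eq_mul i _ _ hz, one_mul]⟩

/-- A family of least size is irredundant, so some `x` lies in all members but `L`; transitivity
modulo `L` moves `x` to 1 without leaving the others. -/
theorem exists_isFrame [UnitalNearRing N] (hdcc : HasDCCN N) (hJ : JTwo N = {0}) :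
    ∃ (ι : Type u) (_ : Fintype ι) (e : ι → N), IsFrame e := by
  classical
  have hex : ∃ k, ∃ F : Finset (AddSubgroup N), (∀ L ∈ F, IsPointAnnihilator L) ∧
      F.inf id = ⊥ ∧ F.card = k := by
    obtain ⟨F, h₁, h₂⟩ := exists_finset_inf_eq_bot hdcc hJ
    exact ⟨_, F, h₁, h₂, rfl⟩
  obtain ⟨F, hF, hbot, hcard⟩ := Nat.find_spec hex
  have hmin : ∀ L ∈ F, ∃ x : N, (∀ M ∈ F, M ≠ L → x ∈ M) ∧ x ∉ L := by
    intro L hL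
    by_contra! hcon
    refine Nat.find_min hex (m := (F.erase L).card) ?_
      ⟨F.erase L, fun M hM => hF M (Finset.mem_of_mem_erase hM), ?_, rfl⟩
    · rw [← hcard]
      exact Finset.card_erase_lt_of_mem hL
    · rw [← hbot]
      refine le_antisymm (Finset.le_inf fun M hM x hx => ?_) (Finset.inf_mono (F.erase_subset L))
      have hx' : ∀ M ∈ F, M ≠ L → x ∈ M := fun M hM hne =>
        (Finset.inf_le (f := id) (Finset.mem_erase.mpr ⟨hne, hM⟩) : _ ≤ id M) hx
      by_cases hne : M = L
      · exact hne ▸ hcon x hx'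
      · exact hx' M hM hne
  have hdual : ∀ L : F, ∃ e : N, e - 1 ∈ L.1 ∧ ∀ M : F, L ≠ M → e ∈ M.1 := by
    rintro ⟨L, hL⟩
    obtain ⟨x, hx, hxL⟩ := hmin L hL
    obtain ⟨z, hz⟩ := (hF L hL).transitive x hxL 1
    exact ⟨z * x, hz, fun M hne => (hF M.1 M.2).mul_mem z
      (hx M.1 M.2 fun h => hne (Subtype.ext h.symm))⟩
  choose e he₁ he₂ using hdual
  refine ⟨F, inferInstance, e, isFrame_of_dual (L := fun L : F => L.1) (fun L => hF L.1 L.2)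
    (fun x hx => ?_) he₁ he₂⟩
  have : x ∈ F.inf id := by
    simpa [Finset.inf_eq_iInf, AddSubgroup.mem_iInf] using hx
  rwa [hbot, AddSubgroup.mem_bot] at this

end Annihilators

/-! ### Frames under the f- or a-condition. -/

section Frames

variable {N : Type u} [UnitalNearRing N] {ι : Type u} {e : ι → N}

/-- Units that agree with `1` on both sides of a non-zero element `c` are trivial; this is what
`f`-near-rings and `a`-near-rings have in common. -/
theorem unit_eq_one_of_fixes (hfa : IsFNearRing N ∨ IsANearRing N) {u v c : N}
    (huv : u * v = 1) (hvu : v * u = 1) (hc : c ≠ 0) (hcu : c * u = c) (huc : u * c = c) :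
    u = 1 := by
  rcases hfa with hf | ha
  · by_contra hne
    let w : Nˣ := ⟨u, v, huv, hvu⟩
    refine hc (hf (rightTranslation w) ⟨w, rfl⟩ (fun h => hne ?_) c hcu)
    have h1 : rightTranslation w (1 : N) = (0 : AddAut N) 1 := by rw [h]
    exact (one_mul u).symm.trans h1
  -- Here `u - 1` is a unit or 0, and it annihilates `c` from the left.
  · have hmem : u + -1 ∈ {x : N | IsUnit x ∨ x = 0} :=
      ha.add_mem u (Or.inl ⟨⟨u, v, huv, hvu⟩, rfl⟩) (-1) (ha.neg_mem 1 (Or.inl isUnit_one))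
    rcases hmem with hunit | hzero
    · refine absurd ((hunit.mul_right_eq_zero).mp ?_) hc
      rw [add_mul, huc, NearRing.neg_mul', one_mul, add_neg_cancel]
    · rwa [← sub_eq_add_neg, sub_eq_zero] at hzero

namespace IsFrame

theorem isNearField_of_subsingleton [Subsingleton ι] (he : IsFrame e) (h01 : (0 : N) ≠ 1) :
    IsNearField N := by
  obtain ⟨i⟩ : Nonempty ι := by
    by_contra h
    exact h01 (he.ext 0 1 fun i => absurd ⟨i⟩ h)
  have hi : e i = 1 := he.ext _ _ fun j => by
    rw [Subsingleton.elim j i, he.idem, one_mul]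
  have hinv : ∀ x : N, x ≠ 0 → ∃ z, z * x = 1 := fun x hx => by
    simpa [hi] using he.minimal i x (by simpa [hi] using hx)
  refine ⟨h01, fun x hx => ?_⟩
  obtain ⟨z, hz⟩ := hinv x hx
  obtain ⟨w, hw⟩ := hinv z (by rintro rfl; exact h01 (by simpa using hz))
  have hwx : w = x := left_inv_eq_right_inv hw hz
  exact ⟨⟨x, z, hwx ▸ hw, hz⟩, rfl⟩

/-- The corner is a near-field, so `g` has an inverse `z` there. The element acting as `g` on block
`i` and as 1 elsewhere is a unit fixing `e j` on both sides, hence equals 1. -/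
theorem corner_eq (he : IsFrame e) (hfa : IsFNearRing N ∨ IsANearRing N) {i j : ι} (hij : i ≠ j)
    {g : N} (hl : e i * g = g) (hr : g * e i = g) (hg : g ≠ 0) : g = e i := by
  classical
  have hinv : ∀ g : N, e i * g = g → g * e i = g → g ≠ 0 →
      ∃ z, e i * z = z ∧ z * e i = z ∧ z * g = e i := by
    intro g hl hr hg
    obtain ⟨z, hz⟩ := he.minimal i g (by rwa [hr])
    refine ⟨e i * z * e i, ?_, ?_, ?_⟩
    · rw [← mul_assoc, ← mul_assoc, he.idem]
    · rw [mul_assoc, he.idem]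
    · rw [hr] at hz
      rw [mul_assoc, hl, mul_assoc, hz, he.idem]
  obtain ⟨z, hzl, hzr, hzg⟩ := hinv g hl hr hg
  obtain ⟨w, hwl, hwr, hwz⟩ := hinv z hzl hzr (by
    rintro rfl
    exact he.ne_zero i (by rw [← hzg, zero_mul]))
  have hwg : w = g := by rw [← hwr, ← hzg, ← mul_assoc, hwz, hl]
  have hgz : g * z = e i := hwg ▸ hwz
  obtain ⟨u, hu⟩ := he.exists_mul_eq (Function.update (fun _ => 1) i g)
  obtain ⟨v, hv⟩ := he.exists_mul_eq (Function.update (fun _ => 1) i z)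
  have hui : u * e i = g := by rw [hu, Function.update_self, hr]
  have hvi : v * e i = z := by rw [hv, Function.update_self, hzr]
  have hul : ∀ l, l ≠ i → u * e l = e l := fun l hl => by
    rw [hu, Function.update_of_ne hl, one_mul]
  have hvl : ∀ l, l ≠ i → v * e l = e l := fun l hl => by
    rw [hv, Function.update_of_ne hl, one_mul]
  have huv : u * v = 1 := he.ext _ _ fun l => by
    by_cases h : l = i
    · rw [h, mul_assoc, hvi, ← hzl, ← mul_assoc, hui, hgz, one_mul]
    · rw [mul_assoc, hvl l h, hul l h, one_mul]
  have hvu : v * u = 1 := he.ext _ _ fun l => by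
    by_cases h : l = i
    · rw [h, mul_assoc, hui, ← hl, ← mul_assoc, hvi, hzg, one_mul]
    · rw [mul_assoc, hul l h, hvl l h, one_mul]
  have hone : u = 1 := by
    refine unit_eq_one_of_fixes hfa huv hvu (he.ne_zero j) (he.ext _ _ fun l => ?_)
      (hul j hij.symm)
    by_cases h : l = i
    · rw [h, mul_assoc, hui, ← hl, ← mul_assoc, he.ortho j i hij.symm, zero_mul]
    · rw [mul_assoc, hul l h]
  rw [← hui, hone, one_mul]

/-- Replacing `a` by `a - a * e l` kills one more block and does not change `a * g`; this stands in
for expanding `a` as an ordered sum of the `a * e l`. -/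
theorem mul_eq_zero_of_forall (he : IsFrame e) {g : N} (s : Finset ι) (hg : ∀ l ∈ s, e l * g = 0)
    {a : N} (ha : ∀ l ∉ s, a * e l = 0) : a * g = 0 := by
  classical
  induction s using Finset.induction_on generalizing a with
  | empty =>
    have : a = 0 := he.ext _ _ fun l => by rw [ha l (Finset.notMem_empty l), zero_mul]
    rw [this, zero_mul]
  | insert l s hls ih =>
    have h := ih (fun m hm => hg m (Finset.mem_insert_of_mem hm)) (a := a - a * e l) fun m hm => by
      by_cases hml : m = l
      · rw [hml, NearRing.sub_mul', mul_assoc, he.idem, sub_self]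
      · rw [NearRing.sub_mul', mul_assoc, he.ortho l m (Ne.symm hml), mul_zero, sub_zero]
        exact ha m (by simp [hml, hm])
    rwa [NearRing.sub_mul', mul_assoc, hg l (Finset.mem_insert_self l s), mul_zero, sub_zero] at h

theorem isRing_of_block (he : IsFrame e) (hcomm : ∀ i (a b : N), a * e i + b * e i = b * e i + a * e i)
    (hdist : ∀ i (n a b : N), n * (a * e i + b * e i) = n * (a * e i) + n * (b * e i)) :
    IsRingNR N := by
  refine ⟨fun a b => he.ext _ _ fun i => ?_, fun n a b => he.ext _ _ fun i => ?_⟩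
  · rw [add_mul, add_mul, hcomm]
  · rw [add_mul, mul_assoc, mul_assoc, mul_assoc, add_mul, hdist]

theorem isRing_of_orthogonal [Fintype ι] [Nontrivial ι] (he : IsFrame e)
    (hfa : IsFNearRing N ∨ IsANearRing N)
    (hzero : ∀ i j, i ≠ j → ∀ x : N, e j * (x * e i) = 0) : IsRingNR N := by
  classical
  -- Unlinked blocks force `e i * (x * e i) = x * e i`, so the whole block lies in the corner.
  have hval : ∀ i (x : N), x * e i = 0 ∨ x * e i = e i := by
    intro i x
    by_cases hx : x * e i = 0
    · exact Or.inl hx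
    · obtain ⟨j, hj⟩ := exists_ne i
      refine Or.inr (he.corner_eq hfa hj.symm ?_ (by rw [mul_assoc, he.idem]) hx)
      have := he.mul_eq_zero_of_forall (g := x * e i) (Finset.univ.erase i)
        (fun l hl => hzero i l (Finset.ne_of_mem_erase hl).symm x) (a := 1 - e i) fun l hl => by
          have hli : l = i := by simpa using hl
          rw [hli, NearRing.sub_mul', one_mul, he.idem, sub_self]
      rw [NearRing.sub_mul', one_mul, sub_eq_zero] at this
      exact this.symm
  have hdouble : ∀ i, e i + e i = 0 := fun i => by
    have h := hval i (1 + 1)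
    rw [add_mul, one_mul] at h
    exact h.resolve_right fun h => he.ne_zero i (by simpa using h)
  refine he.isRing_of_block (fun i a b => ?_) fun i n a b => ?_
  · rcases hval i a with ha | ha <;> rcases hval i b with hb | hb <;> simp [ha, hb]
  · rcases hval i a with ha | ha <;> rcases hval i b with hb | hb <;>
      rcases hval i n with hn | hn <;> simp [ha, hb, hn, hdouble]

/-- Two isomorphic blocks `N * e i`, `N * e j` are interchanged by mutually inverse elements. -/
theorem exists_matrix_units (he : IsFrame e) (hfa : IsFNearRing N ∨ IsANearRing N) {i j : ι}
    (hij : i ≠ j) {x : N} (hx : e j * (x * e i) ≠ 0) :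
    ∃ p q : N, e j * p = p ∧ p * e i = p ∧ e i * q = q ∧ q * e j = q ∧
      q * p = e i ∧ p * q = e j := by
  set p := e j * (x * e i) with hp
  have hpl : e j * p = p := by rw [hp, ← mul_assoc, he.idem]
  have hpr : p * e i = p := by rw [hp, mul_assoc, mul_assoc, he.idem]
  obtain ⟨z, hz⟩ := he.minimal i p (by rwa [hpr])
  rw [hpr] at hz
  have hql : e i * (e i * z * e j) = e i * z * e j := by rw [← mul_assoc, ← mul_assoc, he.idem]
  have hqr : e i * z * e j * e j = e i * z * e j := by rw [mul_assoc, he.idem]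
  have hqp : e i * z * e j * p = e i := by rw [mul_assoc, hpl, mul_assoc, hz, he.idem]
  refine ⟨p, e i * z * e j, hpl, hpr, hql, hqr, hqp, ?_⟩
  refine he.corner_eq hfa hij.symm (by rw [← mul_assoc, hpl]) (by rw [mul_assoc, hqr]) ?_
  intro h
  refine hx ?_
  rw [← hpr, ← hqp, ← mul_assoc, h, zero_mul]

/-- The involution `u` exchanging blocks `i` and `j` and trivial elsewhere would fix a third `e l`
on both sides, hence be 1. -/
theorem eq_or_eq_of_matrix_units (he : IsFrame e) (hfa : IsFNearRing N ∨ IsANearRing N) {i j : ι}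
    (hij : i ≠ j) {p q : N} (hpl : e j * p = p) (hpr : p * e i = p) (hql : e i * q = q)
    (hqr : q * e j = q) (hqp : q * p = e i) (hpq : p * q = e j) (l : ι) : l = i ∨ l = j := by
  classical
  by_contra! hl
  obtain ⟨u, hu⟩ := he.exists_mul_eq (Function.update (Function.update (fun _ => 1) i p) j q)
  have hui : u * e i = p := by
    rw [hu, Function.update_of_ne hij, Function.update_self, hpr]
  have huj : u * e j = q := by rw [hu, Function.update_self, hqr]
  have hul : ∀ m, m ≠ i → m ≠ j → u * e m = e m := fun m h₁ h₂ => by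
    rw [hu, Function.update_of_ne h₂, Function.update_of_ne h₁, one_mul]
  have huu : u * u = 1 := he.ext _ _ fun m => by
    by_cases h₁ : m = i
    · rw [h₁, mul_assoc, hui, ← hpl, ← mul_assoc, huj, hqp, one_mul]
    by_cases h₂ : m = j
    · rw [h₂, mul_assoc, huj, ← hql, ← mul_assoc, hui, hpq, one_mul]
    rw [mul_assoc, hul m h₁ h₂, hul m h₁ h₂, one_mul]
  have hone : u = 1 := by
    refine unit_eq_one_of_fixes hfa huu huu (he.ne_zero l) (he.ext _ _ fun m => ?_)
      (hul l hl.1 hl.2)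
    by_cases h₁ : m = i
    · rw [h₁, mul_assoc, hui, ← hpl, ← mul_assoc, he.ortho l j hl.2, zero_mul, he.ortho l i hl.1]
    by_cases h₂ : m = j
    · rw [h₂, mul_assoc, huj, ← hql, ← mul_assoc, he.ortho l i hl.1, zero_mul, he.ortho l j hl.2]
    rw [mul_assoc, hul m h₁ h₂]
  rw [hone, one_mul] at hui
  refine he.ne_zero i ?_
  rw [← he.idem i]
  nth_rw 2 [hui]
  rw [← hpl, ← mul_assoc, he.ortho i j hij, zero_mul]

/-- With two isomorphic blocks, any further non-zero point of a block forces `N` to be a ring. -/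
theorem isRing_of_third_point (he : IsFrame e) (hfa : IsFNearRing N ∨ IsANearRing N) {i j : ι}
    (hij : i ≠ j) {p q : N} (hpl : e j * p = p) (hpr : p * e i = p) (hql : e i * q = q)
    (hqr : q * e j = q) (hqp : q * p = e i) (hpq : p * q = e j) {g : N} (hg : g * e i = g)
    (hg₀ : g ≠ 0) (hgi : g ≠ e i) (hgp : g ≠ p) : IsRingNR N := by
  have hall := he.eq_or_eq_of_matrix_units hfa hij hpl hpr hql hqr hqp hpq
  have hsum : ∀ n : N, n * e i + n * e j = n := fun n => he.ext _ _ fun l => by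
    rcases hall l with rfl | rfl
    · rw [add_mul, mul_assoc, mul_assoc, he.idem, he.ortho j l hij.symm, mul_zero, add_zero]
    · rw [add_mul, mul_assoc, mul_assoc, he.idem, he.ortho i l hij, mul_zero, zero_add]
  have hsum' : ∀ n : N, n * e j + n * e i = n := fun n => he.ext _ _ fun l => by
    rcases hall l with rfl | rfl
    · rw [add_mul, mul_assoc, mul_assoc, he.idem, he.ortho j l hij.symm, mul_zero, zero_add]
    · rw [add_mul, mul_assoc, mul_assoc, he.idem, he.ortho i l hij, mul_zero, add_zero]
  have hig : e i * g = 0 ∨ e i * g = e i := or_iff_not_imp_left.mpr fun h =>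
    he.corner_eq hfa hij (by rw [← mul_assoc, he.idem]) (by rw [mul_assoc, hg]) h
  have hjg : e j * g = 0 ∨ e j * g = p := or_iff_not_imp_left.mpr fun h => by
    have hqg : q * g = e i := by
      refine he.corner_eq hfa hij (by rw [← mul_assoc, hql]) (by rw [mul_assoc, hg]) fun h' => h ?_
      rw [← hpq, mul_assoc, h', mul_zero]
    rw [← hpq, mul_assoc, hqg, hpr]
  have hdec : e i * g + e j * g = g := by
    have := hsum 1
    rw [one_mul, one_mul] at this
    rw [← add_mul, this, one_mul]
  have hig' : e i * g = e i := hig.resolve_left fun h => by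
    rw [h, zero_add] at hdec
    rcases hjg with h' | h'
    exacts [hg₀ (hdec.symm.trans h'), hgp (hdec.symm.trans h')]
  have hjg' : e j * g = p := hjg.resolve_left fun h => by
    rw [h, add_zero] at hdec
    exact hgi (hdec.symm.trans hig')
  -- Now `g = e i + p`, while 1 is the sum of `e i` and `e j` in either order; so `n * g` expands in
  -- both orders.
  have hng : ∀ n : N, n * g = n * e i + n * p := fun n => by
    conv_lhs => rw [← hsum n]
    rw [add_mul, mul_assoc, mul_assoc, hig', hjg']
  have hng' : ∀ n : N, n * g = n * p + n * e i := fun n => by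
    conv_lhs => rw [← hsum' n]
    rw [add_mul, mul_assoc, mul_assoc, hig', hjg']
  -- Any two points of the block are `n * e i` and `n * p` for a common `n`, so the two expansions
  -- of `n * g` give commutativity, and associativity gives left distributivity.
  have hpoint : ∀ a b : N, ∃ n : N, n * e i = a * e i ∧ n * p = b * e i := fun a b => by
    classical
    obtain ⟨n, hn⟩ := he.exists_mul_eq (Function.update (fun _ => a) j (b * q))
    refine ⟨n, by rw [hn, Function.update_of_ne hij], ?_⟩
    rw [← hpl, ← mul_assoc, hn, Function.update_self, mul_assoc, hpl, mul_assoc, hqp]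
  have hcomm : ∀ a b : N, a * e i + b * e i = b * e i + a * e i := fun a b => by
    obtain ⟨n, h₁, h₂⟩ := hpoint a b
    rw [← h₁, ← h₂, ← hng, ← hng']
  have hdist : ∀ n a b : N, n * (a * e i + b * e i) = n * (a * e i) + n * (b * e i) :=
    fun n a b => by
      obtain ⟨m, h₁, h₂⟩ := hpoint a b
      rw [← h₁, ← h₂, ← hng, ← mul_assoc, hng, mul_assoc, mul_assoc]
  -- Right multiplication by `q` transports both laws from block `i` to block `j`.
  have hej : ∀ a : N, a * e j = a * p * e i * q := fun a => by
    rw [mul_assoc, hql, mul_assoc, hpq]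
  refine he.isRing_of_block (fun l a b => ?_) fun l n a b => ?_
  · rcases hall l with rfl | rfl
    · exact hcomm a b
    · rw [hej a, hej b, ← add_mul, hcomm, add_mul]
  · rcases hall l with rfl | rfl
    · exact hdist n a b
    · rw [hej a, hej b, ← add_mul, ← mul_assoc, hdist, add_mul, mul_assoc, mul_assoc n]

/-- With two isomorphic three-element blocks, `N` is the near-ring of all zero-fixing self-maps of
such a block. -/
theorem nonempty_equiv_mZero (he : IsFrame e) {i j : ι} (hij : i ≠ j)
    (hall : ∀ l, l = i ∨ l = j) {p q : N} (hpl : e j * p = p) (hpr : p * e i = p)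
    (hqp : q * p = e i) (hpq : p * q = e j)
    (hpts : ∀ g : N, g * e i = g → g = 0 ∨ g = e i ∨ g = p) :
    Nonempty (N ≃+* MZero (ZMod 3)) := by
  classical
  have hi₀ := he.ne_zero i
  have hp₀ : p ≠ 0 := by
    rintro rfl
    exact hi₀ (by rw [← hqp, mul_zero])
  have hip : e i ≠ p := fun h => hi₀ (by
    rw [← he.idem i]
    nth_rw 2 [h]
    rw [← hpl, ← mul_assoc, he.ortho i j hij, zero_mul])
  -- Cancellation excludes every other value, so the block is cyclic of order 3, generated by `e i`.
  have hsum : e i + p = 0 := by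
    rcases hpts (e i + p) (by rw [add_mul, he.idem, hpr]) with h | h | h
    · exact h
    · exact absurd (by simpa using h) hp₀
    · exact absurd (by simpa using h) hi₀
  have hdouble : e i + e i = p := by
    rcases hpts (e i + e i) (by rw [add_mul, he.idem]) with h | h | h
    · exact absurd (add_left_cancel (h.trans hsum.symm)) hip
    · exact absurd (by simpa using h) hi₀
    · exact h
  have hsum' : p + e i = 0 := by rw [← hdouble, add_assoc, hdouble, hsum]
  have hpdouble : p + p = e i := by
    nth_rw 1 [← hdouble]
    rw [add_assoc, hsum, add_zero]
  let τ : ZMod 3 → N := ![0, e i, p]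
  have τ0 : τ 0 = 0 := rfl
  have τ1 : τ 1 = e i := rfl
  have τ2 : τ 2 = p := rfl
  have hτadd : ∀ k l, τ (k + l) = τ k + τ l := by
    intro k l
    fin_cases k <;> fin_cases l
    · exact (add_zero (0 : N)).symm
    · exact (zero_add (e i)).symm
    · exact (zero_add p).symm
    · exact (add_zero (e i)).symm
    · exact hdouble.symm
    · exact hsum.symm
    · exact (add_zero p).symm
    · exact hsum'.symm
    · exact hpdouble.symm
  have hτinj : Function.Injective τ := by
    intro k l
    fin_cases k <;> fin_cases l <;> intro h
    · rfl
    · exact absurd h.symm hi₀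
    · exact absurd h.symm hp₀
    · exact absurd h hi₀
    · rfl
    · exact absurd h hip
    · exact absurd h hp₀
    · exact absurd h.symm hip
    · rfl
  have hτmul : ∀ k, τ k * e i = τ k := by
    intro k
    fin_cases k
    exacts [zero_mul _, he.idem i, hpr]
  have hτsurj : ∀ g : N, g * e i = g → ∃ k, τ k = g := by
    intro g hg
    rcases hpts g hg with rfl | rfl | rfl
    exacts [⟨0, rfl⟩, ⟨1, rfl⟩, ⟨2, rfl⟩]
  have hact : ∀ (n : N) (k : ZMod 3), ∃ l, τ l = n * τ k := fun n k =>
    hτsurj _ (by rw [mul_assoc, hτmul])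
  choose φ hφ using hact
  let Φ : N → MZero (ZMod 3) := fun n => ⟨φ n, hτinj (by rw [hφ, τ0, mul_zero])⟩
  have hΦ : Function.Bijective Φ := by
    refine ⟨fun m n hmn => ?_, fun f => ?_⟩
    · have hk : ∀ k, m * τ k = n * τ k := fun k => by
        rw [← hφ, ← hφ]
        exact congrArg τ (congrFun (congrArg MZero.toFun hmn) k)
      refine he.ext _ _ fun l => ?_
      rcases hall l with rfl | rfl
      · exact hk 1
      · rw [← hpq, ← mul_assoc, ← mul_assoc]
        exact congrArg (· * q) (hk 2)
    -- The value at `p` is prescribed through block `j`: the factor `q` is undone by `q * p = e i`.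
    · obtain ⟨n, hn⟩ := he.exists_mul_eq
        (Function.update (fun _ => τ (f.toFun 1)) j (τ (f.toFun 2) * q))
      refine ⟨n, MZero.ext (funext fun k => hτinj ?_)⟩
      change τ (φ n k) = τ (f.toFun k)
      rw [hφ]
      fin_cases k
      · exact (mul_zero n).trans (congrArg τ f.map_zero').symm
      · change n * e i = τ (f.toFun 1)
        rw [hn, Function.update_of_ne hij, hτmul]
      · change n * p = τ (f.toFun 2)
        rw [← hpl, ← mul_assoc, hn, Function.update_self, mul_assoc, hpl, mul_assoc, hqp, hτmul]
  exact ⟨{ Equiv.ofBijective Φ hΦ with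
      map_mul' := fun m n => MZero.ext (funext fun k => hτinj (by
        change τ (φ (m * n) k) = τ (φ m (φ n k))
        rw [hφ, hφ, hφ, mul_assoc]))
      map_add' := fun m n => MZero.ext (funext fun k => hτinj (by
        change τ (φ (m + n) k) = τ (φ m k + φ n k)
        rw [hτadd, hφ, hφ, hφ, add_mul])) }⟩

end IsFrame

end Frames

theorem mainTheorem4 (N : Type*) [UnitalNearRing N]
    (hfa : IsFNearRing N ∨ IsANearRing N) (hdcc : HasDCCN N) (hring : ¬ IsRingNR N)
    (hJ : JTwo N = {0}) :
    IsNearField N ∨ Nonempty (N ≃+* MZero (ZMod 3)) := by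
  obtain ⟨ι, _, e, he⟩ := exists_isFrame hdcc hJ
  rcases subsingleton_or_nontrivial ι with _ | _
  -- If `0 = 1` (the case of an empty frame), `N` is trivial and so a ring.
  · refine Or.inl (he.isNearField_of_subsingleton fun h01 => hring ?_)
    have hsub : ∀ a b : N, a = b := fun a b => by
      rw [← mul_one a, ← mul_one b, ← h01, mul_zero, mul_zero]
    exact ⟨fun _ _ => hsub _ _, fun _ _ _ => hsub _ _⟩
  · by_cases hzero : ∀ i j, i ≠ j → ∀ x : N, e j * (x * e i) = 0
    · exact absurd (he.isRing_of_orthogonal hfa hzero) hring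
    · push Not at hzero
      obtain ⟨i, j, hij, x, hx⟩ := hzero
      obtain ⟨p, q, hpl, hpr, hql, hqr, hqp, hpq⟩ := he.exists_matrix_units hfa hij hx
      refine Or.inr (he.nonempty_equiv_mZero hij
        (he.eq_or_eq_of_matrix_units hfa hij hpl hpr hql hqr hqp hpq) hpl hpr hqp hpq
        fun g hg => ?_)
      by_contra! h
      exact hring (he.isRing_of_third_point hfa hij hpl hpr hql hqr hqp hpq hg h.1 h.2.1 h.2.2)
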